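/- Let $[d]=\{0,\dots,d-1\}$; for $\boldsymbol a\in\mathbb R^d$ let $\mathrm{Toep}(\boldsymbol a)\in\mathbb R^{d\times d}$ be the symmetric Toeplitz matrix with entries $a_{|j-k|}$; let $\|\cdot\|_2$ be the operator norm. A set $R\subseteq[d]$ is a ruler if for every $s\in[d]$ the set $R_s=\{(j,k)\in R\times R: |j-k|=s\}$ is non-empty. Let $T=\mathrm{Toep}(\boldsymbol a)\in\mathbb R^{d\times d}$ be positive semidefinite and banded with bandwidth $m$, i.e. $0<m<d$ and $a_s=0$ for all $s\ge m$. Let $R\subseteq[d]$ be a ruler, $\Delta>0$ and $p>1$ real. Let $\boldsymbol x^{(1)},\dots,\boldsymbol x^{(n)}$ be i.i.d. $\mathcal N(0,T)$, and let the dithers $\tau^{(l)}_j$ ($1\le l\le n$, $j\in[d]$) be i.i.d., independent of the samples, each distributed as the sum of two independent uniform variables on $[-\Delta/2,\Delta/2]$. The quantized data are $\dot x^{(l)}_j=\mathcal Q_\Delta(x^{(l)}_j+\tau^{(l)}_j)$ with $\mathcal Q_\Delta(u)=\Delta(\lfloor u/\Delta\rfloor+\tfrac12)$, and the estimator is $$\hat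 T=\mathrm{Toep}(\dot{\boldsymbol a})-\tfrac{\Delta^2}{4}I_d,\qquad \dot a_s=\frac1{n|R_s|}\sum_{l=1}^n\sum_{(j,k)\in R_s}\dot x^{(l)}_j\dot x^{(l)}_k .$$ Put $K=2(\|T\|_2+2\Delta^2)$ and, for a threshold $\zeta$, let $\breve T_\zeta$ be obtained from $\hat T$ by replacing every entry of absolute value less than $\zeta$ by $0$. Theorem. For every constant $c>0$ there is a constant $C_0>0$, depending only on $c$, such that for every $C\ge C_0$ there is a constant $C'>0$, depending only on $c$ and $C$, with the following property. For all $d,m,n,T,R,\Delta,p$ and all samples and dithers as above, if $$n\ \ge\ c\,(\log|R|+4p\log d)$$ (in particular whenever $n=\Theta(\log|R|+4p\log d)$ with lower implied constant $c$), then for $$\zeta=C\,K\sqrt{\frac{\log|R|+4p\log d}{n}}$$ one has, with probability at least $1-e^{-p}$, $$\|T-\breve T_\zeta\|_2\ \le\ C'\,K\,m\,\sqrt{\frac{\log|R|+4p\log d}{n}} .$$ -/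

import Mathlib

open MeasureTheory ProbabilityTheory

noncomputable section

namespace QToep

/-- The distance `|j - k|` of two indices in `{0, …, d-1}`. -/
def dist {d : ℕ} (j k : Fin d) : ℕ := ((j : ℤ) - (k : ℤ)).natAbs

lemma dist_lt {d : ℕ} (j k : Fin d) : dist j k < d := by
  unfold dist
  omega

/-- The symmetric Toeplitz matrix with entries `a_{|j-k|}`. -/
def toep {d : ℕ} (a : Fin d → ℝ) : Matrix (Fin d) (Fin d) ℝ :=
  Matrix.of fun j k => a ⟨dist j k, dist_lt j k⟩

/-- The operator (spectral) norm of a real square matrix. -/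
def opNorm {d : ℕ} (A : Matrix (Fin d) (Fin d) ℝ) : ℝ :=
  ‖Matrix.toEuclideanCLM (n := Fin d) (𝕜 := ℝ) A‖

/-- `R` is a ruler: every distance `0, …, d-1` is attained by two elements of `R`. -/
def IsRuler {d : ℕ} (R : Finset (Fin d)) : Prop :=
  ∀ s : Fin d, ∃ j ∈ R, ∃ k ∈ R, dist j k = s

/-- The set `R_s` of ordered pairs in `R × R` with distance `s`. -/
def pairs {d : ℕ} (R : Finset (Fin d)) (s : Fin d) : Finset (Fin d × Fin d) :=
  (R ×ˢ R).filter fun q => dist q.1 q.2 = s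

/-- The scalar quantizer `Q_Δ(x) = Δ (⌊x / Δ⌋ + 1/2)`. -/
def quantize (Δ x : ℝ) : ℝ := Δ * ((⌊x / Δ⌋ : ℝ) + 1 / 2)

/-- The uniform distribution on `[-Δ/2, Δ/2]`. -/
def uniformDither (Δ : ℝ) : Measure ℝ := cond volume (Set.Icc (-Δ / 2) (Δ / 2))

/-- The triangular dither distribution: the law of the sum of two independent uniform
variables on `[-Δ/2, Δ/2]`. -/
def triangularDither (Δ : ℝ) : Measure ℝ :=
  (uniformDither Δ).conv (uniformDither Δ)

/-- The quantities `ȧ_s`, averages of products of entries of the quantized data `y^(l)`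
over all `n` samples and all pairs of `R` at distance `s`. -/
def aDot {d n : ℕ} (R : Finset (Fin d)) (y : Fin n → Fin d → ℝ) (s : Fin d) : ℝ :=
  (1 / ((n : ℝ) * ((pairs R s).card : ℝ))) * ∑ l, ∑ q ∈ pairs R s, y l q.1 * y l q.2

/-- The estimator `T̂ = Toep(ȧ) - (Δ²/4) I` computed from the quantized data `y`. -/
def estimator {d n : ℕ} (Δ : ℝ) (R : Finset (Fin d)) (y : Fin n → Fin d → ℝ) :
    Matrix (Fin d) (Fin d) ℝ :=
  toep (aDot R y) - (Δ ^ 2 / 4) • (1 : Matrix (Fin d) (Fin d) ℝ)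

/-- Entrywise hard thresholding at level `ζ`: an entry is kept if its absolute value is at
least `ζ`, and is replaced by zero otherwise. -/
def threshold {d : ℕ} (ζ : ℝ) (A : Matrix (Fin d) (Fin d) ℝ) : Matrix (Fin d) (Fin d) ℝ :=
  Matrix.of fun j k => if ζ ≤ |A j k| then A j k else 0

/-- The sampling model: the samples `x^(1), …, x^(n)` are i.i.d. `N(0, T)`, all the dither
entries `τ^(l)_j` are i.i.d. triangular with level `Δ`, and the dithers are independent of
the samples. -/
structure IsDitheredGaussianSample {d n : ℕ} {Ω : Type*} [MeasurableSpace Ω] (P : Measure Ω)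
    (T : Matrix (Fin d) (Fin d) ℝ) (Δ : ℝ)
    (x : Fin n → Ω → EuclideanSpace ℝ (Fin d)) (τ : Fin n → Fin d → Ω → ℝ) : Prop where
  law_sample : ∀ l, HasLaw (x l) (multivariateGaussian 0 T) P
  indep_sample : iIndepFun x P
  law_dither : ∀ l j, HasLaw (τ l j) (triangularDither Δ) P
  indep_dither : iIndepFun (fun q : Fin n × Fin d => τ q.1 q.2) P
  indep_sample_dither : IndepFun (fun ω l => x l ω) (fun ω l j => τ l j ω) P

/-- The quantized data `ẋ^(l)_j = Q_Δ(x^(l)_j + τ^(l)_j)` at an outcome `ω`. -/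
def quantizedData {d n : ℕ} {Ω : Type*} (Δ : ℝ) (x : Fin n → Ω → EuclideanSpace ℝ (Fin d))
    (τ : Fin n → Fin d → Ω → ℝ) (ω : Ω) : Fin n → Fin d → ℝ :=
  fun l j => quantize Δ (x l ω j + τ l j ω)

/-- The quantity `log |R| + 4 p log d`. -/
def logTerm {d : ℕ} (R : Finset (Fin d)) (p : ℝ) : ℝ :=
  Real.log (R.card : ℝ) + 4 * p * Real.log (d : ℝ)

/-- The quantity `K = 2 (‖T‖₂ + 2 Δ²)`. -/
def scaleK {d : ℕ} (T : Matrix (Fin d) (Fin d) ℝ) (Δ : ℝ) : ℝ :=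
  2 * (opNorm T + 2 * Δ ^ 2)

end QToep

end

noncomputable section

namespace QToep

/-! The argument is entrywise. If every entry of the estimator is within `η ≤ ζ` of `T`,
thresholding at `ζ` kills everything outside the band and costs at most `η + ζ` inside it. A matrix
of bandwidth `m` has at most `2m` non-zero entries per row and column, so Schur's test turns this
into an operator norm error of `2m(η + ζ)` (`opNorm_sub_threshold_le`).

Entrywise accuracy has two ingredients. Triangular dither makes the first two conditional moments of
the quantized value exact: the mean is the input and the second moment exceeds its square by `Δ²/4`,
whatever the input. Hence products of quantized coordinates have mean `T + (Δ²/4) I`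
(`integral_quantizedProduct`). Such a product is dominated by squares of Gaussians plus a multiple
of `Δ²`, so after division by a multiple of `K` it has a bounded exponential moment, and a Bernstein
bound applies to the sum over the `n` independent samples
(`IsDitheredGaussianSample.measureReal_abs_sum_ge_le`).

A union bound over the `d²` index pairs finishes the proof. Averaging over a set `R_s` preserves the
accuracy because all its pairs share one mean; no independence within `R_s` is needed. -/

/-! ### Operator norm of banded matrices, and thresholding. -/

/-- Schur's test: Cauchy–Schwarz with weights `|A j k|` uses the row sums, and exchanging the order
of summation uses the column sums. -/
lemma opNorm_le_of_row_col_sum {d : ℕ} {A : Matrix (Fin d) (Fin d) ℝ} {S : ℝ} (hS : 0 ≤ S)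
    (hrow : ∀ j, ∑ k, |A j k| ≤ S) (hcol : ∀ k, ∑ j, |A j k| ≤ S) : opNorm A ≤ S := by
  refine ContinuousLinearMap.opNorm_le_bound _ hS fun x => ?_
  refine le_of_sq_le_sq ?_ (by positivity)
  rw [mul_pow, EuclideanSpace.real_norm_sq_eq, EuclideanSpace.real_norm_sq_eq]
  have key : ∀ j, ((Matrix.toEuclideanCLM (n := Fin d) (𝕜 := ℝ) A) x) j ^ 2 ≤
      S * ∑ k, |A j k| * x k ^ 2 := by
    intro j
    have h1 : ((Matrix.toEuclideanCLM (n := Fin d) (𝕜 := ℝ) A) x) j = ∑ k, A j k * x k := rfl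
    rw [h1]
    have h2 := Finset.sum_sq_le_sum_mul_sum_of_sq_le_mul Finset.univ
      (r := fun k => A j k * x k) (f := fun k => |A j k|) (g := fun k => |A j k| * x k ^ 2)
      (fun _ _ => abs_nonneg _) (fun _ _ => by positivity)
      (fun k _ => by rw [← mul_assoc, ← pow_two, sq_abs, mul_pow])
    exact h2.trans (mul_le_mul_of_nonneg_right (hrow j)
      (Finset.sum_nonneg fun _ _ => by positivity))
  calc ∑ j, ((Matrix.toEuclideanCLM (n := Fin d) (𝕜 := ℝ) A) x) j ^ 2
      ≤ ∑ j, S * ∑ k, |A j k| * x k ^ 2 := Finset.sum_le_sum fun j _ => key j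
    _ = S * ∑ k, (∑ j, |A j k|) * x k ^ 2 := by
        rw [← Finset.mul_sum, Finset.sum_comm]
        simp_rw [Finset.sum_mul]
    _ ≤ S * ∑ k, S * x k ^ 2 := by
        gcongr with k
        exact hcol k
    _ = S ^ 2 * ∑ k, x k ^ 2 := by rw [← Finset.mul_sum]; ring

lemma dist_comm {d : ℕ} (j k : Fin d) : dist j k = dist k j := by
  unfold dist; omega

lemma card_dist_lt_le {d : ℕ} (m : ℕ) (j : Fin d) :
    (Finset.univ.filter fun k : Fin d => dist j k < m).card ≤ 2 * m := by
  -- Passing to `ℤ` keeps `j - m` from being truncated at zero.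
  have h : ((Finset.univ.filter fun k : Fin d => dist j k < m).image fun k : Fin d => ((k : ℕ) : ℤ)) ⊆
      Finset.Ico ((j : ℤ) - m) (j + m) := by
    intro z hz
    obtain ⟨k, hk, rfl⟩ := Finset.mem_image.1 hz
    have hk' := (Finset.mem_filter.1 hk).2
    unfold dist at hk'
    rw [Finset.mem_Ico]
    omega
  have h2 := Finset.card_le_card h
  rw [Finset.card_image_of_injective _ (fun a b hab => Fin.ext (by simpa using hab)),
    Int.card_Ico] at h2
  omega

lemma sum_abs_le_of_banded {d : ℕ} (m : ℕ) {b : ℝ} (f : Fin d → ℝ) (j : Fin d)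
    (hf : ∀ k, |f k| ≤ b) (hf0 : ∀ k, m ≤ dist j k → f k = 0) : ∑ k, |f k| ≤ 2 * m * b := by
  have hb : 0 ≤ b := (abs_nonneg _).trans (hf j)
  calc ∑ k, |f k| = ∑ k with dist j k < m, |f k| := by
        rw [Finset.sum_filter]
        refine Finset.sum_congr rfl fun k _ => ?_
        split_ifs with h
        · rfl
        · rw [hf0 k (not_lt.1 h), abs_zero]
    _ ≤ ∑ k with dist j k < m, b := Finset.sum_le_sum fun k _ => hf k
    _ ≤ 2 * m * b := by
        rw [Finset.sum_const, nsmul_eq_mul]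
        gcongr
        exact_mod_cast card_dist_lt_le m j

/-- A banded matrix with bounded entries has operator norm at most twice the bandwidth times the
bound on the entries. -/
lemma opNorm_le_of_banded {d : ℕ} (m : ℕ) {b : ℝ} (hb : 0 ≤ b) {A : Matrix (Fin d) (Fin d) ℝ}
    (hA : ∀ j k, |A j k| ≤ b) (hA0 : ∀ j k, m ≤ dist j k → A j k = 0) :
    opNorm A ≤ 2 * m * b :=
  opNorm_le_of_row_col_sum (by positivity)
    (fun j => sum_abs_le_of_banded m _ j (hA j) (hA0 j))
    (fun k => sum_abs_le_of_banded m (fun j => A j k) k (fun j => hA j k)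
      fun j h => hA0 j k (by rwa [dist_comm]))

/-- The entry is a coordinate of the image of a unit vector. This bounds the variances of the
samples by the norm occurring in `scaleK`. -/
lemma apply_self_le_opNorm {d : ℕ} (A : Matrix (Fin d) (Fin d) ℝ) (j : Fin d) :
    A j j ≤ opNorm A := by
  have h1 := (Matrix.toEuclideanCLM (n := Fin d) (𝕜 := ℝ) A).le_opNorm
    (EuclideanSpace.single j (1 : ℝ))
  rw [PiLp.norm_single, norm_one, mul_one] at h1
  refine le_trans ?_ h1
  have h2 := PiLp.norm_apply_le
    ((Matrix.toEuclideanCLM (n := Fin d) (𝕜 := ℝ) A) (EuclideanSpace.single j (1 : ℝ))) j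
  refine le_trans ?_ h2
  have h3 : ((Matrix.toEuclideanCLM (n := Fin d) (𝕜 := ℝ) A)
      (EuclideanSpace.single j (1 : ℝ))) j = A j j := by
    simp
  rw [h3]
  exact le_abs_self _

/-- If the estimate is entrywise close to a banded matrix, then hard thresholding above the
entrywise accuracy is close in operator norm. -/
lemma opNorm_sub_threshold_le {d : ℕ} (m : ℕ) {η ζ : ℝ} (hη : 0 ≤ η) (hηζ : η ≤ ζ)
    {T E : Matrix (Fin d) (Fin d) ℝ} (hT : ∀ j k, m ≤ dist j k → T j k = 0)
    (hE : ∀ j k, |E j k - T j k| < η) :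
    opNorm (T - threshold ζ E) ≤ 2 * m * (η + ζ) := by
  refine opNorm_le_of_banded m (by linarith) (fun j k => ?_) fun j k h => ?_
  -- A kept entry errs by less than `η`; a zeroed one satisfies `|E j k| < ζ`, so `|T j k| < η + ζ`.
  · have h := abs_lt.1 (hE j k)
    simp only [Matrix.sub_apply, threshold, Matrix.of_apply]
    split_ifs with h1
    · rw [abs_le]; constructor <;> linarith
    · have h2 := abs_lt.1 (not_le.1 h1)
      rw [abs_le]; constructor <;> linarith
  -- Outside the band `|E j k| < η ≤ ζ`, so the entry is always zeroed.
  · have h1 := hE j k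
    rw [hT j k h, sub_zero] at h1
    simp only [Matrix.sub_apply, threshold, Matrix.of_apply, hT j k h]
    rw [if_neg (by linarith), sub_zero]

/-! ### The quantizer under uniform and triangular dither. -/

lemma abs_quantize_sub_le {Δ : ℝ} (hΔ : 0 < Δ) (u : ℝ) : |quantize Δ u - u| ≤ Δ / 2 := by
  have h1 : quantize Δ u - u = Δ * (1 / 2 - Int.fract (u / Δ)) := by
    unfold quantize Int.fract
    field_simp
    ring
  rw [h1, abs_mul, abs_of_pos hΔ]
  have h2 := Int.fract_nonneg (u / Δ)
  have h3 := Int.fract_lt_one (u / Δ)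
  have h4 : |1 / 2 - Int.fract (u / Δ)| ≤ 1 / 2 := by
    rw [abs_le]; constructor <;> linarith
  nlinarith

@[fun_prop]
lemma measurable_quantize (Δ : ℝ) : Measurable (quantize Δ) := by
  unfold quantize
  fun_prop

/-- On a unit interval the floor jumps once, at `⌊z⌋ + 1`, which cuts the interval into lengths `1 -
Int.fract z` and `Int.fract z`. -/
lemma intervalIntegral_floor (g : ℤ → ℝ) (z : ℝ) :
    ∫ t in z..(z + 1), g ⌊t⌋ = (1 - Int.fract z) * g ⌊z⌋ + Int.fract z * g (⌊z⌋ + 1) := by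
  set M := ⌊z⌋ with hM
  have h0 : z = M + Int.fract z := (Int.floor_add_fract z).symm
  have hf0 := Int.fract_nonneg z
  have hf1 := Int.fract_lt_one z
  have e1 : Set.EqOn (fun _ => g M) (fun t : ℝ => g ⌊t⌋) (Set.uIoo z (M + 1)) := by
    rw [Set.uIoo_of_le (by linarith)]
    intro t ht
    have : ⌊t⌋ = M := Int.floor_eq_iff.2 ⟨by linarith [ht.1], ht.2⟩
    simp only [this]
  have e2 : Set.EqOn (fun _ => g (M + 1)) (fun t : ℝ => g ⌊t⌋) (Set.uIoo ((M : ℝ) + 1) (z + 1)) := by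
    rw [Set.uIoo_of_le (by linarith)]
    intro t ht
    have : ⌊t⌋ = M + 1 := Int.floor_eq_iff.2 ⟨by push_cast; linarith [ht.1],
      by push_cast; linarith [ht.2]⟩
    simp only [this]
  rw [← intervalIntegral.integral_add_adjacent_intervals (b := (M : ℝ) + 1)
    (intervalIntegrable_const.congr_uIoo e1) (intervalIntegrable_const.congr_uIoo e2),
    ← intervalIntegral.integral_congr_uIoo e1, ← intervalIntegral.integral_congr_uIoo e2,
    intervalIntegral.integral_const, intervalIntegral.integral_const, smul_eq_mul, smul_eq_mul]
  have h2 : (M : ℝ) + 1 - z = 1 - Int.fract z := by linarith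
  have h3 : z + 1 - (M + 1) = Int.fract z := by linarith
  rw [h2, h3]

lemma volume_Icc_half {Δ : ℝ} : volume (Set.Icc (-Δ / 2) (Δ / 2)) = ENNReal.ofReal Δ := by
  rw [Real.volume_Icc]
  congr 1
  ring

lemma isProbabilityMeasure_uniformDither {Δ : ℝ} (hΔ : 0 < Δ) :
    IsProbabilityMeasure (uniformDither Δ) := by
  refine cond_isProbabilityMeasure_of_finite ?_ ?_
  · rw [volume_Icc_half]; simpa using hΔ
  · rw [volume_Icc_half]; simp

lemma ae_uniformDither_abs_le (Δ : ℝ) : ∀ᵐ u ∂(uniformDither Δ), |u| ≤ Δ / 2 := by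
  have h : ∀ᵐ u ∂(volume.restrict (Set.Icc (-Δ / 2) (Δ / 2))), |u| ≤ Δ / 2 := by
    filter_upwards [ae_restrict_mem measurableSet_Icc] with u hu
    rw [abs_le]
    exact ⟨by linarith [hu.1], hu.2⟩
  exact Measure.ae_smul_measure h _

lemma integral_uniformDither {Δ : ℝ} (hΔ : 0 < Δ) (f : ℝ → ℝ) :
    ∫ u, f u ∂(uniformDither Δ) = Δ⁻¹ * ∫ u in (-Δ / 2)..(Δ / 2), f u := by
  unfold uniformDither ProbabilityTheory.cond
  rw [integral_smul_measure, volume_Icc_half, integral_Icc_eq_integral_Ioc,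
    ← intervalIntegral.integral_of_le (by linarith)]
  simp [hΔ.le]

lemma integral_uniformDither_comp {Δ : ℝ} (hΔ : 0 < Δ) (F : ℝ → ℝ) (v : ℝ) :
    ∫ u, F ((v + u) / Δ) ∂(uniformDither Δ) =
      ∫ t in (v / Δ - 1 / 2)..(v / Δ - 1 / 2 + 1), F t := by
  rw [integral_uniformDither hΔ]
  simp_rw [add_div]
  rw [intervalIntegral.integral_comp_add_div F hΔ.ne', smul_eq_mul, ← mul_assoc,
    inv_mul_cancel₀ hΔ.ne', one_mul]
  congr 1 <;> field_simp <;> ring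

lemma integrable_uniformDither_of_bound {Δ : ℝ} (hΔ : 0 < Δ) {f : ℝ → ℝ} (hf : Measurable f)
    (C : ℝ) (hC : ∀ u, |u| ≤ Δ / 2 → |f u| ≤ C) : Integrable f (uniformDither Δ) := by
  have := isProbabilityMeasure_uniformDither hΔ
  exact Integrable.of_bound hf.aestronglyMeasurable C
    ((ae_uniformDither_abs_le Δ).mono fun u hu => hC u hu)

lemma integral_quantize_uniformDither {Δ : ℝ} (hΔ : 0 < Δ) (v : ℝ) :
    ∫ u, quantize Δ (v + u) ∂(uniformDither Δ) = v := by
  have h1 := integral_uniformDither_comp hΔ (fun t => Δ * ((⌊t⌋ : ℝ) + 1 / 2)) v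
  have h2 := intervalIntegral_floor (fun M => Δ * ((M : ℝ) + 1 / 2)) (v / Δ - 1 / 2)
  unfold quantize
  rw [h1, h2]
  have h0 := Int.floor_add_fract (v / Δ - 1 / 2)
  have h3 : v = Δ * (⌊v / Δ - 1 / 2⌋ + Int.fract (v / Δ - 1 / 2) + 1 / 2) := by
    rw [h0]; field_simp; ring
  conv_rhs => rw [h3]
  push_cast
  ring

/-- Under one uniform dither the output takes two adjacent levels with probabilities `1 - f` and
`f`, where `f` is the fractional part, and has mean `v`. Its variance is thus the Bernoulli variance
`Δ² (f - f²)`, which still depends on `v`; the second uniform averages it out. -/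
lemma integral_quantize_sq_uniformDither {Δ : ℝ} (hΔ : 0 < Δ) (v : ℝ) :
    ∫ u, quantize Δ (v + u) ^ 2 ∂(uniformDither Δ) =
      v ^ 2 + Δ ^ 2 * (Int.fract (v / Δ - 1 / 2) - Int.fract (v / Δ - 1 / 2) ^ 2) := by
  have h1 := integral_uniformDither_comp hΔ (fun t => (Δ * ((⌊t⌋ : ℝ) + 1 / 2)) ^ 2) v
  have h2 := intervalIntegral_floor (fun M => (Δ * ((M : ℝ) + 1 / 2)) ^ 2) (v / Δ - 1 / 2)
  unfold quantize
  rw [h1, h2]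
  have h0 := Int.floor_add_fract (v / Δ - 1 / 2)
  have h3 : v ^ 2 = (Δ * (⌊v / Δ - 1 / 2⌋ + Int.fract (v / Δ - 1 / 2) + 1 / 2)) ^ 2 := by
    rw [h0]; field_simp; ring
  rw [h3]
  push_cast
  ring

lemma integral_add_uniformDither {Δ : ℝ} (hΔ : 0 < Δ) (v : ℝ) :
    ∫ u, (v + u) ∂(uniformDither Δ) = v := by
  rw [integral_uniformDither hΔ, intervalIntegral.integral_comp_add_left (fun x => x), integral_id]
  field_simp
  ring

lemma integral_add_sq_uniformDither {Δ : ℝ} (hΔ : 0 < Δ) (v : ℝ) :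
    ∫ u, (v + u) ^ 2 ∂(uniformDither Δ) = v ^ 2 + Δ ^ 2 / 12 := by
  rw [integral_uniformDither hΔ, intervalIntegral.integral_comp_add_left (fun x => x ^ 2),
    integral_pow]
  field_simp
  ring

/-- The integrand is 1-periodic in the rescaled variable, so its average does not depend on `v` and
equals the integral of `t - t²` over the unit interval. -/
lemma integral_fract_sub_sq_uniformDither {Δ : ℝ} (hΔ : 0 < Δ) (v : ℝ) :
    ∫ u, (Int.fract ((v + u) / Δ - 1 / 2) - Int.fract ((v + u) / Δ - 1 / 2) ^ 2)
      ∂(uniformDither Δ) = 1 / 6 := by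
  rw [integral_uniformDither_comp hΔ
    (fun t => Int.fract (t - 1 / 2) - Int.fract (t - 1 / 2) ^ 2) v]
  have hper : Function.Periodic
      (fun t : ℝ => Int.fract (t - 1 / 2) - Int.fract (t - 1 / 2) ^ 2) 1 := by
    intro t
    have : Int.fract (t + 1 - 1 / 2) = Int.fract (t - 1 / 2) := by
      rw [show t + 1 - 1 / 2 = t - 1 / 2 + 1 by ring, Int.fract_add_one]
    simp only [this]
  rw [hper.intervalIntegral_add_eq _ (1 / 2)]
  have e : Set.EqOn (fun t : ℝ => Int.fract (t - 1 / 2) - Int.fract (t - 1 / 2) ^ 2)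
      (fun t => (t - 1 / 2) - (t - 1 / 2) ^ 2) (Set.uIoo (1 / 2) (1 / 2 + 1)) := by
    rw [Set.uIoo_of_le (by norm_num)]
    intro t ht
    have : Int.fract (t - 1 / 2) = t - 1 / 2 :=
      Int.fract_eq_self.2 ⟨by linarith [ht.1], by linarith [ht.2]⟩
    simp only [this]
  rw [intervalIntegral.integral_congr_uIoo e,
    intervalIntegral.integral_comp_sub_right (fun t => t - t ^ 2),
    intervalIntegral.integral_sub (by simp) (by simp), integral_id, integral_pow]
  norm_num

lemma isProbabilityMeasure_triangularDither {Δ : ℝ} (hΔ : 0 < Δ) :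
    IsProbabilityMeasure (triangularDither Δ) := by
  have := isProbabilityMeasure_uniformDither hΔ
  unfold triangularDither
  infer_instance

lemma ae_triangularDither_abs_le {Δ : ℝ} (hΔ : 0 < Δ) :
    ∀ᵐ s ∂(triangularDither Δ), |s| ≤ Δ := by
  have := isProbabilityMeasure_uniformDither hΔ
  unfold triangularDither Measure.conv
  rw [ae_map_iff (by fun_prop) (measurableSet_le (by fun_prop) (by fun_prop))]
  have h1 : ∀ᵐ z ∂((uniformDither Δ).prod (uniformDither Δ)), |z.1| ≤ Δ / 2 :=
    Measure.quasiMeasurePreserving_fst.ae (ae_uniformDither_abs_le Δ)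
  have h2 : ∀ᵐ z ∂((uniformDither Δ).prod (uniformDither Δ)), |z.2| ≤ Δ / 2 :=
    Measure.quasiMeasurePreserving_snd.ae (ae_uniformDither_abs_le Δ)
  filter_upwards [h1, h2] with z hz1 hz2
  linarith [abs_add_le z.1 z.2]

lemma abs_quantize_add_le {Δ : ℝ} (hΔ : 0 < Δ) (v : ℝ) {s : ℝ} (hs : |s| ≤ Δ) :
    |quantize Δ (v + s)| ≤ |v| + 3 / 2 * Δ := by
  have h1 := abs_quantize_sub_le hΔ (v + s)
  have h2 : quantize Δ (v + s) = (quantize Δ (v + s) - (v + s)) + (v + s) := by ring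
  rw [h2]
  linarith [abs_add_le (quantize Δ (v + s) - (v + s)) (v + s), abs_add_le v s]

lemma integrable_triangularDither_of_bound {Δ : ℝ} (hΔ : 0 < Δ) {f : ℝ → ℝ} (hf : Measurable f)
    (C : ℝ) (hC : ∀ u, |u| ≤ Δ → |f u| ≤ C) : Integrable f (triangularDither Δ) := by
  have := isProbabilityMeasure_triangularDither hΔ
  exact Integrable.of_bound hf.aestronglyMeasurable C
    ((ae_triangularDither_abs_le hΔ).mono fun u hu => hC u hu)

lemma integrable_quantize_triangularDither {Δ : ℝ} (hΔ : 0 < Δ) (v : ℝ) :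
    Integrable (fun s => quantize Δ (v + s)) (triangularDither Δ) :=
  integrable_triangularDither_of_bound hΔ (by fun_prop) (|v| + 3 / 2 * Δ)
    fun _ hs => abs_quantize_add_le hΔ v hs

lemma integrable_quantize_sq_triangularDither {Δ : ℝ} (hΔ : 0 < Δ) (v : ℝ) :
    Integrable (fun s => quantize Δ (v + s) ^ 2) (triangularDither Δ) :=
  integrable_triangularDither_of_bound hΔ (by fun_prop) ((|v| + 3 / 2 * Δ) ^ 2)
    fun _ hs => by
      rw [abs_pow]
      exact pow_le_pow_left₀ (abs_nonneg _) (abs_quantize_add_le hΔ v hs) 2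

/-- The quantized dithered value is unbiased. -/
lemma integral_quantize_triangularDither {Δ : ℝ} (hΔ : 0 < Δ) (v : ℝ) :
    ∫ s, quantize Δ (v + s) ∂(triangularDither Δ) = v := by
  have := isProbabilityMeasure_uniformDither hΔ
  have h := integral_conv (integrable_quantize_triangularDither hΔ v)
  change ∫ s, quantize Δ (v + s) ∂(triangularDither Δ) = _ at h
  rw [h]
  simp_rw [← add_assoc, integral_quantize_uniformDither hΔ]
  exact integral_add_uniformDither hΔ v

/-- The second moment of the quantization noise under triangular dither is `Δ² / 4`, whatever the
input. -/
lemma integral_quantize_sq_triangularDither {Δ : ℝ} (hΔ : 0 < Δ) (v : ℝ) :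
    ∫ s, quantize Δ (v + s) ^ 2 ∂(triangularDither Δ) = v ^ 2 + Δ ^ 2 / 4 := by
  have := isProbabilityMeasure_uniformDither hΔ
  have h := integral_conv (integrable_quantize_sq_triangularDither hΔ v)
  change ∫ s, quantize Δ (v + s) ^ 2 ∂(triangularDither Δ) = _ at h
  rw [h]
  simp_rw [← add_assoc, integral_quantize_sq_uniformDither hΔ]
  -- The noise `Δ²/4` is `Δ²/12`, the variance of the outer uniform, plus `Δ²/6`, the averaged
  -- Bernoulli variance.
  rw [integral_add, integral_const_mul, integral_add_sq_uniformDither hΔ,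
    integral_fract_sub_sq_uniformDither hΔ]
  · ring
  · refine integrable_uniformDither_of_bound hΔ (by fun_prop) ((|v| + Δ / 2) ^ 2) fun u hu => ?_
    rw [abs_pow]
    exact pow_le_pow_left₀ (abs_nonneg _) (by linarith [abs_add_le v u]) 2
  · refine (integrable_uniformDither_of_bound hΔ (by fun_prop) 1 fun u _ => ?_).const_mul _
    have h1 := Int.fract_nonneg ((v + u) / Δ - 1 / 2)
    have h2 := Int.fract_lt_one ((v + u) / Δ - 1 / 2)
    rw [abs_le]
    constructor <;> nlinarith

/-! ### A Bernstein inequality from an exponential moment. -/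

lemma exp_sub_one_sub_id_le_sq_mul_exp_abs (u : ℝ) :
    Real.exp u ≤ 1 + u + u ^ 2 * Real.exp |u| := by
  have h1 := Real.add_one_le_exp u
  have h2 : Real.exp u - 1 ≤ u * Real.exp u := by
    have h3 := Real.add_one_le_exp (-u)
    have h4 : Real.exp (-u) * Real.exp u = 1 := by rw [← Real.exp_add]; simp
    nlinarith [Real.exp_pos u]
  rcases le_total 0 u with hu | hu
  · rw [abs_of_nonneg hu]
    nlinarith
  · have h5 := Real.one_le_exp (abs_nonneg u)
    nlinarith [sq_nonneg u]

lemma sq_le_mul_exp_half {w : ℝ} (hw : 0 ≤ w) : w ^ 2 ≤ 16 * Real.exp (w / 2) := by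
  have h1 := Real.add_one_le_exp (w / 4)
  have h2 : Real.exp (w / 2) = Real.exp (w / 4) ^ 2 := by
    rw [← Real.exp_nat_mul]; congr 1; push_cast; ring
  rw [h2]
  nlinarith

/-- The restriction on `t` spends half of `exp |w|` on `exp |t * w|`; the other half absorbs `w ^
2`, at the cost of the factor 16. -/
lemma exp_mul_le_of_abs_le_half {t w : ℝ} (ht : |t| ≤ 1 / 2) :
    Real.exp (t * w) ≤ 1 + t * w + 16 * t ^ 2 * Real.exp |w| := by
  refine (exp_sub_one_sub_id_le_sq_mul_exp_abs (t * w)).trans ?_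
  gcongr 1 + t * w + ?_
  have h1 := sq_le_mul_exp_half (abs_nonneg w)
  have h2 : Real.exp |t * w| ≤ Real.exp (|w| / 2) := by
    rw [abs_mul]
    gcongr
    nlinarith [abs_nonneg w]
  have h3 : Real.exp |w| = Real.exp (|w| / 2) * Real.exp (|w| / 2) := by
    rw [← Real.exp_add]; congr 1; ring
  calc (t * w) ^ 2 * Real.exp |t * w| ≤ (t * w) ^ 2 * Real.exp (|w| / 2) := by gcongr
    _ = t ^ 2 * (|w| ^ 2 * Real.exp (|w| / 2)) := by rw [sq_abs]; ring
    _ ≤ t ^ 2 * (16 * Real.exp (|w| / 2) * Real.exp (|w| / 2)) := by gcongr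
    _ = _ := by rw [h3]; ring

section Bernstein

variable {Ω : Type*} [MeasurableSpace Ω] {P : Measure Ω}

lemma integrable_of_integrable_exp_abs [IsFiniteMeasure P] {W : Ω → ℝ} (hW : AEMeasurable W P)
    (hint : Integrable (fun ω => Real.exp |W ω|) P) : Integrable W P := by
  refine hint.mono' hW.aestronglyMeasurable (Filter.Eventually.of_forall fun ω => ?_)
  rw [Real.norm_eq_abs]
  linarith [Real.add_one_le_exp |W ω|]

lemma integrable_exp_mul_of_integrable_exp_abs {W : Ω → ℝ} (hW : AEMeasurable W P)
    (hint : Integrable (fun ω => Real.exp |W ω|) P) {t : ℝ} (ht : |t| ≤ 1 / 2) :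
    Integrable (fun ω => Real.exp (t * W ω)) P := by
  refine hint.mono' (hW.const_mul t).exp.aestronglyMeasurable
    (Filter.Eventually.of_forall fun ω => ?_)
  rw [Real.norm_eq_abs, Real.abs_exp]
  refine Real.exp_le_exp.2 ((le_abs_self _).trans ?_)
  rw [abs_mul]
  nlinarith [abs_nonneg (W ω)]

/-- A Bernstein type bound for the moment generating function of a centred variable with a finite
exponential moment. -/
lemma mgf_sub_integral_le [IsProbabilityMeasure P] {W : Ω → ℝ} (hW : AEMeasurable W P)
    (hint : Integrable (fun ω => Real.exp |W ω|) P) {M : ℝ}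
    (hM : ∫ ω, Real.exp |W ω| ∂P ≤ M) {t : ℝ} (ht : |t| ≤ 1 / 2) :
    mgf (fun ω => W ω - ∫ ω', W ω' ∂P) P t ≤ Real.exp (16 * M * t ^ 2) := by
  set μ := ∫ ω', W ω' ∂P with hμ
  have hWi := integrable_of_integrable_exp_abs hW hint
  have h1 : ∫ ω, Real.exp (t * W ω) ∂P ≤ 1 + t * μ + 16 * t ^ 2 * M := by
    calc ∫ ω, Real.exp (t * W ω) ∂P
        ≤ ∫ ω, (1 + t * W ω + 16 * t ^ 2 * Real.exp |W ω|) ∂P :=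
          integral_mono (integrable_exp_mul_of_integrable_exp_abs hW hint ht)
            (((integrable_const _).add (hWi.const_mul t)).add (hint.const_mul _))
            fun ω => exp_mul_le_of_abs_le_half ht
      _ = 1 + t * μ + 16 * t ^ 2 * ∫ ω, Real.exp |W ω| ∂P := by
          have h3 : Integrable (fun ω => 1 + t * W ω) P :=
            (integrable_const _).add (hWi.const_mul t)
          rw [integral_add h3 (hint.const_mul _), integral_add (integrable_const _) (hWi.const_mul t), integral_const_mul,
            integral_const_mul]
          simp [hμ]
      _ ≤ _ := by gcongr
  have h2 : mgf (fun ω => W ω - μ) P t = Real.exp (-(t * μ)) * ∫ ω, Real.exp (t * W ω) ∂P := by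
    rw [mgf, ← integral_const_mul]
    congr 1 with ω
    rw [← Real.exp_add]
    ring_nf
  rw [h2]
  calc Real.exp (-(t * μ)) * ∫ ω, Real.exp (t * W ω) ∂P
      ≤ Real.exp (-(t * μ)) * Real.exp (t * μ + 16 * t ^ 2 * M) := by
        gcongr
        refine h1.trans ?_
        linarith [Real.add_one_le_exp (t * μ + 16 * t ^ 2 * M)]
    _ = _ := by rw [← Real.exp_add]; congr 1; ring

/-- Chernoff's bound: independence factors the moment generating function of the sum. The parameter
`t` is left free, to be chosen in terms of `n` and the log term. -/
lemma measureReal_sum_sub_integral_ge_le {n : ℕ} {W : Fin n → Ω → ℝ}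
    [IsProbabilityMeasure P] (hW : ∀ l, AEMeasurable (W l) P) (hindep : iIndepFun W P)
    (hint : ∀ l, Integrable (fun ω => Real.exp |W l ω|) P) {M : ℝ}
    (hM : ∀ l, ∫ ω, Real.exp |W l ω| ∂P ≤ M) {t : ℝ} (ht0 : 0 ≤ t) (ht : t ≤ 1 / 2) (ε : ℝ) :
    P.real {ω | ε ≤ ∑ l, (W l ω - ∫ ω', W l ω' ∂P)} ≤
      Real.exp (-t * ε + n * (16 * M * t ^ 2)) := by
  have ht' : |t| ≤ 1 / 2 := by rwa [abs_of_nonneg ht0]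
  have hY : ∀ l, AEMeasurable (fun ω => W l ω - ∫ ω', W l ω' ∂P) P :=
    fun l => (hW l).sub_const _
  have hYind : iIndepFun (fun l ω => W l ω - ∫ ω', W l ω' ∂P) P :=
    hindep.comp (fun l x => x - ∫ ω', W l ω' ∂P) fun l => by fun_prop
  have hYint : ∀ l, Integrable (fun ω => Real.exp (t * (W l ω - ∫ ω', W l ω' ∂P))) P := by
    intro l
    have h := (integrable_exp_mul_of_integrable_exp_abs (hW l) (hint l) ht').const_mul
      (Real.exp (-(t * ∫ ω', W l ω' ∂P)))
    refine h.congr (Filter.Eventually.of_forall fun ω => ?_)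
    simp only
    rw [← Real.exp_add]
    congr 1
    ring
  have hsum : Integrable
      (fun ω => Real.exp (t * (∑ l, fun ω => W l ω - ∫ ω', W l ω' ∂P) ω)) P := by
    -- A non-integrable function has integral 0, whereas by independence this one is a product of
    -- positive factors.
    by_contra hni
    have h0 := hYind.mgf_sum₀ (t := t) hY Finset.univ
    rw [mgf, integral_undef hni] at h0
    exact (Finset.prod_pos fun l _ => mgf_pos (hYint l)).ne h0
  have h1 := measure_ge_le_exp_mul_mgf ε ht0 hsum
  rw [hYind.mgf_sum₀ hY] at h1
  simp only [Finset.sum_apply] at h1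
  refine h1.trans ?_
  rw [Real.exp_add]
  gcongr
  calc ∏ l, mgf (fun ω => W l ω - ∫ ω', W l ω' ∂P) P t
      ≤ ∏ _l : Fin n, Real.exp (16 * M * t ^ 2) :=
        Finset.prod_le_prod (fun l _ => mgf_nonneg)
          fun l _ => mgf_sub_integral_le (hW l) (hint l) (hM l) ht'
    _ = _ := by rw [Finset.prod_const, Finset.card_univ, Fintype.card_fin, ← Real.exp_nat_mul]

/-- Two-sided Bernstein inequality for sums of independent variables with a common bound on an
exponential moment. -/
lemma measureReal_abs_sum_sub_integral_ge_le {n : ℕ} {W : Fin n → Ω → ℝ}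
    [IsProbabilityMeasure P] (hW : ∀ l, AEMeasurable (W l) P) (hindep : iIndepFun W P)
    (hint : ∀ l, Integrable (fun ω => Real.exp |W l ω|) P) {M : ℝ}
    (hM : ∀ l, ∫ ω, Real.exp |W l ω| ∂P ≤ M) {t : ℝ} (ht0 : 0 ≤ t) (ht : t ≤ 1 / 2) (ε : ℝ) :
    P.real {ω | ε ≤ |∑ l, (W l ω - ∫ ω', W l ω' ∂P)|} ≤
      2 * Real.exp (-t * ε + n * (16 * M * t ^ 2)) := by
  have h1 := measureReal_sum_sub_integral_ge_le hW hindep hint hM ht0 ht ε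
  have h2 := measureReal_sum_sub_integral_ge_le (W := fun l ω => -W l ω) (fun l => (hW l).neg)
    (hindep.comp (fun _ x => -x) fun _ => measurable_neg) (by simpa using hint) (by simpa using hM)
    ht0 ht ε
  have hsub : {ω | ε ≤ |∑ l, (W l ω - ∫ ω', W l ω' ∂P)|} ⊆
      {ω | ε ≤ ∑ l, (W l ω - ∫ ω', W l ω' ∂P)} ∪
        {ω | ε ≤ ∑ l, (-W l ω - ∫ ω', -W l ω' ∂P)} := by
    intro ω hω
    have h3 : ∑ l, (-W l ω - ∫ ω', -W l ω' ∂P) = -∑ l, (W l ω - ∫ ω', W l ω' ∂P) := by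
      rw [← Finset.sum_neg_distrib]
      refine Finset.sum_congr rfl fun l _ => ?_
      rw [integral_neg]
      ring
    simp only [Set.mem_union, Set.mem_ofPred_eq] at hω ⊢
    rw [h3]
    exact le_abs.1 hω
  refine (measureReal_mono hsub).trans ((measureReal_union_le _ _).trans ?_)
  linarith

end Bernstein

/-! ### Exponential moments of the square of a real Gaussian. -/

lemma integral_exp_mul_sq_gaussianReal {v : NNReal} (hv : v ≠ 0) {t : ℝ} (ht : t * v ≤ 1 / 4) :
    ∫ x, Real.exp (t * x ^ 2) ∂(gaussianReal 0 v) = √(1 / (1 - 2 * (t * v))) := by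
  have hv' : (0 : ℝ) < v := by positivity
  rw [integral_gaussianReal_eq_integral_smul hv]
  have h1 : ∀ x : ℝ, gaussianPDFReal 0 v x • Real.exp (t * x ^ 2) =
      (√(2 * Real.pi * v))⁻¹ * Real.exp (-(1 / (2 * v) - t) * x ^ 2) := by
    intro x
    rw [gaussianPDFReal, smul_eq_mul, mul_assoc, ← Real.exp_add]
    congr 2
    field_simp
    ring
  simp_rw [h1]
  rw [integral_const_mul, integral_gaussian, ← Real.sqrt_inv, ← Real.sqrt_mul (by positivity)]
  congr 1
  have h2 : (1 : ℝ) / (2 * v) - t = (1 - 2 * (t * v)) / (2 * v) := by field_simp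
  have h3 : (1 : ℝ) - 2 * (t * v) ≠ 0 := by linarith
  rw [h2]
  field_simp

lemma integrable_exp_mul_sq_gaussianReal {v : NNReal} {t : ℝ} (ht : t * v ≤ 1 / 4) :
    Integrable (fun x => Real.exp (t * x ^ 2)) (gaussianReal 0 v) := by
  rcases eq_or_ne v 0 with rfl | hv
  · rw [gaussianReal_zero_var]
    exact integrable_dirac (by simp)
  -- Integrability is read off the closed form: it is positive, while the default integral of a
  -- non-integrable function is 0.
  · by_contra h
    have h1 := integral_exp_mul_sq_gaussianReal hv ht
    rw [integral_undef h] at h1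
    have h2 : 0 < √(1 / (1 - 2 * (t * v))) := Real.sqrt_pos.2 (by
      apply one_div_pos.2; linarith)
    linarith

lemma integral_exp_mul_sq_gaussianReal_le {v : NNReal} {t : ℝ} (ht : t * v ≤ 1 / 4) :
    ∫ x, Real.exp (t * x ^ 2) ∂(gaussianReal 0 v) ≤ 2 := by
  rcases eq_or_ne v 0 with rfl | hv
  · rw [gaussianReal_zero_var]
    simp
  · rw [integral_exp_mul_sq_gaussianReal hv ht, Real.sqrt_le_left (by norm_num)]
    rw [div_le_iff₀ (by linarith)]
    linarith

/-! ### Independence of the pairs (sample, dither vector) and their common law. -/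

section Independence

variable {Ω : Type*} [MeasurableSpace Ω] {P : Measure Ω} [IsProbabilityMeasure P]

/-- In terms of laws, this is the measure-preserving rearrangement of a product of two product
measures into a product of pairs. -/
lemma iIndepFun_prodMk {ι β γ : Type*} [Fintype ι] [MeasurableSpace β] [MeasurableSpace γ]
    {X : ι → Ω → β} {Y : ι → Ω → γ} (mX : ∀ i, AEMeasurable (X i) P)
    (mY : ∀ i, AEMeasurable (Y i) P) (hX : iIndepFun X P) (hY : iIndepFun Y P)
    (hXY : IndepFun (fun ω i => X i ω) (fun ω i => Y i ω) P) :
    iIndepFun (fun i ω => (X i ω, Y i ω)) P := by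
  have mXY : ∀ i, AEMeasurable (fun ω => (X i ω, Y i ω)) P := fun i => (mX i).prodMk (mY i)
  have : ∀ i, IsProbabilityMeasure (P.map (X i)) := fun i => Measure.isProbabilityMeasure_map (mX i)
  have : ∀ i, IsProbabilityMeasure (P.map (Y i)) := fun i => Measure.isProbabilityMeasure_map (mY i)
  have hpair : ∀ i, P.map (fun ω => (X i ω, Y i ω)) = (P.map (X i)).prod (P.map (Y i)) := by
    intro i
    refine (indepFun_iff_map_prod_eq_prod_map_map (mX i) (mY i)).1 ?_
    exact hXY.comp (measurable_pi_apply i) (measurable_pi_apply i)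
  have hall := (indepFun_iff_map_prod_eq_prod_map_map (aemeasurable_pi_lambda _ mX)
    (aemeasurable_pi_lambda _ mY)).1 hXY
  rw [hX.map_fun_eq_pi_map mX, hY.map_fun_eq_pi_map mY] at hall
  have hmp := (measurePreserving_arrowProdEquivProdArrow β γ ι (fun i => P.map (X i))
    (fun i => P.map (Y i))).symm
  refine (iIndepFun_iff_map_fun_eq_pi_map mXY).2 ?_
  simp_rw [hpair]
  rw [← hmp.map_eq, ← hall, AEMeasurable.map_map_of_aemeasurable hmp.measurable.aemeasurable
    ((aemeasurable_pi_lambda _ mX).prodMk (aemeasurable_pi_lambda _ mY))]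
  rfl

lemma iIndepFun_curry {ι κ β : Type*} [Fintype ι] [Fintype κ] [MeasurableSpace β]
    {X : ι → κ → Ω → β} (mX : ∀ i j, AEMeasurable (X i j) P)
    (hX : iIndepFun (fun q : ι × κ => X q.1 q.2) P) : iIndepFun (fun i ω j => X i j ω) P := by
  have hp : ∀ i j, IsProbabilityMeasure (P.map (X i j)) :=
    fun i j => Measure.isProbabilityMeasure_map (mX i j)
  have mX' : ∀ i, AEMeasurable (fun ω j => X i j ω) P := fun i => aemeasurable_pi_lambda _ (mX i)
  refine (iIndepFun_iff_map_fun_eq_pi_map mX').2 ?_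
  have h1 : ∀ i, P.map (fun ω j => X i j ω) = Measure.pi fun j => P.map (X i j) := fun i =>
    (hX.precomp (g := fun j => (i, j)) fun a b h => (Prod.ext_iff.1 h).2).map_fun_eq_pi_map (mX i)
  have h2 := hX.map_fun_eq_pi_map (fun q : ι × κ => mX q.1 q.2)
  have h3 := Measure.infinitePi_map_curry (fun i j => P.map (X i j))
  simp only [Measure.infinitePi_eq_pi] at h3
  simp_rw [h1]
  rw [← h3, ← h2, AEMeasurable.map_map_of_aemeasurable
    (MeasurableEquiv.measurable _).aemeasurable (aemeasurable_pi_lambda _ fun q : ι × κ => mX q.1 q.2)]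
  rfl

variable {d n : ℕ} {T : Matrix (Fin d) (Fin d) ℝ} {Δ : ℝ}
  {x : Fin n → Ω → EuclideanSpace ℝ (Fin d)} {τ : Fin n → Fin d → Ω → ℝ}

lemma IsDitheredGaussianSample.iIndepFun_pair (h : IsDitheredGaussianSample P T Δ x τ) :
    iIndepFun (fun l ω => (x l ω, fun j => τ l j ω)) P :=
  iIndepFun_prodMk (fun l => (h.law_sample l).aemeasurable)
    (fun l => aemeasurable_pi_lambda _ fun j => (h.law_dither l j).aemeasurable) h.indep_sample
    (iIndepFun_curry (fun l j => (h.law_dither l j).aemeasurable) h.indep_dither)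
    h.indep_sample_dither

/-- The joint law of one sample and its dither vector. -/
def sampleLaw (T : Matrix (Fin d) (Fin d) ℝ) (Δ : ℝ) :
    Measure (EuclideanSpace ℝ (Fin d) × (Fin d → ℝ)) :=
  (multivariateGaussian 0 T).prod (Measure.pi fun _ => triangularDither Δ)

lemma IsDitheredGaussianSample.hasLaw_pair (h : IsDitheredGaussianSample P T Δ x τ) (l : Fin n) :
    HasLaw (fun ω => (x l ω, fun j => τ l j ω)) (sampleLaw T Δ) P where
  aemeasurable := (h.law_sample l).aemeasurable.prodMk
    (aemeasurable_pi_lambda _ fun j => (h.law_dither l j).aemeasurable)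
  map_eq := by
    have h1 : IndepFun (x l) (fun ω j => τ l j ω) P :=
      h.indep_sample_dither.comp (measurable_pi_apply l) (measurable_pi_apply l)
    have h2 := (h.indep_dither.precomp (g := fun j => (l, j))
      fun a b h => (Prod.ext_iff.1 h).2).map_fun_eq_pi_map fun j => (h.law_dither l j).aemeasurable
    rw [(indepFun_iff_map_prod_eq_prod_map_map (h.law_sample l).aemeasurable
      (aemeasurable_pi_lambda _ fun j => (h.law_dither l j).aemeasurable)).1 h1, sampleLaw,
      (h.law_sample l).map_eq]
    congr 1
    refine h2.trans ?_
    congr 1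
    funext j
    exact (h.law_dither l j).map_eq

end Independence

/-! ### Moments of products of quantized coordinates. -/

section Moments

variable {d : ℕ} {T : Matrix (Fin d) (Fin d) ℝ} {Δ : ℝ}

/-- The product of two quantized dithered coordinates. -/
def quantizedProduct (Δ : ℝ) (j k : Fin d) (z : EuclideanSpace ℝ (Fin d) × (Fin d → ℝ)) : ℝ :=
  quantize Δ (z.1 j + z.2 j) * quantize Δ (z.1 k + z.2 k)

@[fun_prop]
lemma measurable_quantizedProduct (Δ : ℝ) (j k : Fin d) :
    Measurable (quantizedProduct Δ j k) := by
  unfold quantizedProduct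
  fun_prop

lemma isProbabilityMeasure_sampleLaw (hΔ : 0 < Δ) : IsProbabilityMeasure (sampleLaw T Δ) := by
  have := isProbabilityMeasure_triangularDither hΔ
  unfold sampleLaw
  infer_instance

lemma ae_sampleLaw_abs_dither_le (hΔ : 0 < Δ) (j : Fin d) :
    ∀ᵐ z ∂(sampleLaw T Δ), |z.2 j| ≤ Δ := by
  have := isProbabilityMeasure_triangularDither hΔ
  have h1 : ∀ᵐ y ∂(Measure.pi fun _ : Fin d => triangularDither Δ), |y j| ≤ Δ :=
    (Measure.quasiMeasurePreserving_eval (fun _ : Fin d => triangularDither Δ) j).ae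
      (ae_triangularDither_abs_le hΔ)
  exact Measure.quasiMeasurePreserving_snd.ae h1

lemma ae_sampleLaw_abs_quantizedProduct_le (hΔ : 0 < Δ) (j k : Fin d) :
    ∀ᵐ z ∂(sampleLaw T Δ),
      |quantizedProduct Δ j k z| ≤ z.1 j ^ 2 + z.1 k ^ 2 + 9 / 2 * Δ ^ 2 := by
  filter_upwards [ae_sampleLaw_abs_dither_le hΔ j, ae_sampleLaw_abs_dither_le hΔ k] with z hj hk
  have h1 := abs_quantize_add_le hΔ (z.1 j) hj
  have h2 := abs_quantize_add_le hΔ (z.1 k) hk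
  rw [quantizedProduct, abs_mul]
  calc _ ≤ (|z.1 j| + 3 / 2 * Δ) * (|z.1 k| + 3 / 2 * Δ) := by gcongr
    _ ≤ |z.1 j| ^ 2 + |z.1 k| ^ 2 + 9 / 2 * Δ ^ 2 := by
      nlinarith [sq_nonneg (|z.1 j| - |z.1 k|), sq_nonneg (|z.1 j| - 3 / 2 * Δ),
        sq_nonneg (|z.1 k| - 3 / 2 * Δ)]
    _ = _ := by rw [sq_abs, sq_abs]

/-- The bounded part `s` costs a factor `e ≤ 3`, and AM–GM decouples `u` and `v`, so no joint law of
two coordinates is needed. -/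
lemma exp_le_of_le_mul_add {B w u v s : ℝ} (hB : 0 < B) (hs : s ≤ B) (hw : w ≤ u + v + s) :
    Real.exp (w / B) ≤ 3 / 2 * (Real.exp (2 / B * u) + Real.exp (2 / B * v)) := by
  have h1 : w / B ≤ 1 + (u / B + v / B) := by
    rw [div_le_iff₀ hB]
    have : (1 + (u / B + v / B)) * B = B + u + v := by field_simp; ring
    linarith
  have h2 : Real.exp 1 ≤ 3 := by linarith [Real.exp_one_lt_d9]
  have h3 : ∀ y, Real.exp (2 / B * y) = Real.exp (y / B) ^ 2 := fun y => by
    rw [← Real.exp_nat_mul]; congr 1; push_cast; ring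
  calc Real.exp (w / B) ≤ Real.exp (1 + (u / B + v / B)) := Real.exp_le_exp.2 h1
    _ = Real.exp 1 * (Real.exp (u / B) * Real.exp (v / B)) := by rw [Real.exp_add, Real.exp_add]
    _ ≤ 3 * (Real.exp (u / B) * Real.exp (v / B)) := by gcongr
    _ ≤ _ := by
      rw [h3, h3]
      nlinarith [sq_nonneg (Real.exp (u / B) - Real.exp (v / B))]

lemma integrable_exp_sq_sampleLaw (hT : T.PosSemidef) (hΔ : 0 < Δ) {t : ℝ} (j : Fin d)
    (ht : t * T j j ≤ 1 / 4) :
    Integrable (fun z => Real.exp (t * z.1 j ^ 2)) (sampleLaw T Δ) := by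
  have := isProbabilityMeasure_triangularDither hΔ
  have hv : ((T j j).toNNReal : ℝ) = T j j := Real.coe_toNNReal _ hT.diag_nonneg
  have hmp := measurePreserving_eval_multivariateGaussian (μ := 0) hT (i := j)
  have h1 : Integrable (fun y : EuclideanSpace ℝ (Fin d) => Real.exp (t * y j ^ 2))
      (multivariateGaussian 0 T) :=
    hmp.integrable_comp_of_integrable (integrable_exp_mul_sq_gaussianReal (by rwa [hv]))
  exact h1.comp_fst _

lemma integral_exp_sq_sampleLaw_le (hT : T.PosSemidef) (hΔ : 0 < Δ) {t : ℝ} (j : Fin d)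
    (ht : t * T j j ≤ 1 / 4) :
    ∫ z, Real.exp (t * z.1 j ^ 2) ∂(sampleLaw T Δ) ≤ 2 := by
  have := isProbabilityMeasure_triangularDither hΔ
  have hv : ((T j j).toNNReal : ℝ) = T j j := Real.coe_toNNReal _ hT.diag_nonneg
  have hmp := measurePreserving_eval_multivariateGaussian (μ := 0) hT (i := j)
  have h1 := integral_exp_mul_sq_gaussianReal_le (v := (T j j).toNNReal) (t := t) (by rwa [hv])
  have h2 : ∫ y : EuclideanSpace ℝ (Fin d), Real.exp (t * y j ^ 2) ∂(multivariateGaussian 0 T) =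
      ∫ s, Real.exp (t * s ^ 2) ∂(gaussianReal 0 (T j j).toNNReal) := by
    have h3 := hmp.map_eq
    rw [PiLp.zero_apply] at h3
    rw [← h3, integral_map (by fun_prop) (by fun_prop)]
  have h4 := integral_fun_fst (μ := multivariateGaussian 0 T)
    (ν := Measure.pi fun _ : Fin d => triangularDither Δ) (fun y => Real.exp (t * y j ^ 2))
  rw [sampleLaw, h4, h2]
  simpa using h1

/-- The condition `8 * T j j ≤ B` places the exponent `2 / B` in the range allowed for Gaussian
squares; each then contributes at most 2, and `6 = 3/2 * (2 + 2)`. -/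
lemma integrable_exp_abs_quantizedProduct (hT : T.PosSemidef) (hΔ : 0 < Δ) {B : ℝ}
    (hTB : ∀ j, 8 * T j j ≤ B) (hΔB : 9 / 2 * Δ ^ 2 ≤ B) (j k : Fin d) :
    Integrable (fun z => Real.exp |quantizedProduct Δ j k z / B|) (sampleLaw T Δ) ∧
      ∫ z, Real.exp |quantizedProduct Δ j k z / B| ∂(sampleLaw T Δ) ≤ 6 := by
  have hB : 0 < B := by nlinarith [sq_pos_of_pos hΔ]
  have ht : ∀ i, 2 / B * T i i ≤ 1 / 4 := fun i => by
    rw [div_mul_eq_mul_div, div_le_iff₀ hB]; linarith [hTB i]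
  have hi : ∀ i, Integrable (fun z => Real.exp (2 / B * z.1 i ^ 2)) (sampleLaw T Δ) :=
    fun i => integrable_exp_sq_sampleLaw hT hΔ i (ht i)
  have hle : ∀ᵐ z ∂(sampleLaw T Δ), Real.exp |quantizedProduct Δ j k z / B| ≤
      3 / 2 * (Real.exp (2 / B * z.1 j ^ 2) + Real.exp (2 / B * z.1 k ^ 2)) := by
    filter_upwards [ae_sampleLaw_abs_quantizedProduct_le hΔ j k] with z hz
    rw [abs_div, abs_of_pos hB]
    exact exp_le_of_le_mul_add hB hΔB hz
  have hbi := ((hi j).add (hi k)).const_mul (3 / 2)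
  have hint : Integrable (fun z => Real.exp |quantizedProduct Δ j k z / B|) (sampleLaw T Δ) := by
    refine hbi.mono' (by fun_prop) (hle.mono fun z hz => ?_)
    rwa [Real.norm_eq_abs, Real.abs_exp]
  refine ⟨hint, (integral_mono_ae hint hbi hle).trans ?_⟩
  simp only [Pi.add_apply]
  rw [integral_const_mul, integral_add (hi j) (hi k)]
  linarith [integral_exp_sq_sampleLaw_le hT hΔ j (ht j), integral_exp_sq_sampleLaw_le hT hΔ k (ht k)]

lemma integrable_quantizedProduct (hT : T.PosSemidef) (hΔ : 0 < Δ) (j k : Fin d) :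
    Integrable (quantizedProduct Δ j k) (sampleLaw T Δ) := by
  have := isProbabilityMeasure_sampleLaw (T := T) hΔ
  -- Any scale dominating the variances would do here; the trace does so since the diagonal is
  -- nonnegative.
  set B := 8 * ∑ i, T i i + 9 / 2 * Δ ^ 2 with hBdef
  have hs : ∀ i, T i i ≤ ∑ i, T i i := fun i =>
    Finset.single_le_sum (f := fun i => T i i) (fun i _ => hT.diag_nonneg) (Finset.mem_univ i)
  have hs0 : 0 ≤ ∑ i, T i i := Finset.sum_nonneg fun i _ => hT.diag_nonneg
  have hΔ2 : 0 < 9 / 2 * Δ ^ 2 := by positivity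
  have h1 := (integrable_exp_abs_quantizedProduct hT hΔ (B := B) (fun i => by linarith [hs i])
    (by linarith) j k).1
  have h2 := (integrable_of_integrable_exp_abs (by fun_prop) h1).mul_const B
  refine h2.congr (Filter.Eventually.of_forall fun z => ?_)
  have : B ≠ 0 := by linarith
  field_simp

lemma integral_mul_multivariateGaussian (hT : T.PosSemidef) (j k : Fin d) :
    ∫ y : EuclideanSpace ℝ (Fin d), y j * y k ∂(multivariateGaussian 0 T) = T j k := by
  have hm : ∀ i, MemLp (fun y : EuclideanSpace ℝ (Fin d) => y i) 2 (multivariateGaussian 0 T) :=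
    fun i => (memLp_id_gaussianReal 2).comp_measurePreserving
      (measurePreserving_eval_multivariateGaussian (μ := 0) hT (i := i))
  have h0 : ∀ i, ∫ y : EuclideanSpace ℝ (Fin d), y i ∂(multivariateGaussian 0 T) = 0 := by
    intro i
    have h3 := (measurePreserving_eval_multivariateGaussian (μ := 0) hT (i := i)).map_eq
    rw [PiLp.zero_apply] at h3
    have h4 := integral_id_gaussianReal (μ := 0) (v := (T i i).toNNReal)
    rwa [← h3, integral_map (by fun_prop) (by fun_prop)] at h4
  have h1 := covariance_eval_multivariateGaussian (μ := 0) hT j k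
  rw [covariance_eq_sub (hm j) (hm k), h0, h0, mul_zero, sub_zero] at h1
  exact h1

/-- The second moments of the quantized data: the covariance, shifted by `Δ² / 4` on the
diagonal. -/
lemma integral_quantizedProduct (hT : T.PosSemidef) (hΔ : 0 < Δ) (j k : Fin d) :
    ∫ z, quantizedProduct Δ j k z ∂(sampleLaw T Δ) =
      T j k + if j = k then Δ ^ 2 / 4 else 0 := by
  have := isProbabilityMeasure_triangularDither hΔ
  have hev := fun i => measurePreserving_eval (fun _ : Fin d => triangularDither Δ) i
  have hint := integrable_quantizedProduct hT hΔ j k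
  unfold sampleLaw at hint ⊢
  rw [integral_prod _ hint]
  have hcomp : ∀ (i : Fin d) (f : ℝ → ℝ), Measurable f →
      ∫ s : Fin d → ℝ, f (s i) ∂(Measure.pi fun _ => triangularDither Δ) =
        ∫ u, f u ∂(triangularDither Δ) := by
    intro i f hf
    exact (hev i).hasLaw.integral_comp hf.aestronglyMeasurable
  have hgauss : Integrable (fun y : EuclideanSpace ℝ (Fin d) => y j * y k)
      (multivariateGaussian 0 T) := by
    have hm : ∀ i, MemLp (fun y : EuclideanSpace ℝ (Fin d) => y i) 2 (multivariateGaussian 0 T) :=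
      fun i => (memLp_id_gaussianReal 2).comp_measurePreserving
        (measurePreserving_eval_multivariateGaussian (μ := 0) hT (i := i))
    exact (hm j).integrable_mul (hm k)
  rcases eq_or_ne j k with rfl | hjk
  · have h1 : ∀ y : EuclideanSpace ℝ (Fin d), ∫ s, quantizedProduct Δ j j (y, s)
        ∂(Measure.pi fun _ => triangularDither Δ) = y j * y j + Δ ^ 2 / 4 := by
      intro y
      have := hcomp j (fun u => quantize Δ (y j + u) ^ 2) (by fun_prop)
      rw [integral_quantize_sq_triangularDither hΔ] at this
      simpa only [quantizedProduct, ← pow_two] using this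
    simp_rw [h1]
    rw [integral_add hgauss (integrable_const _), integral_mul_multivariateGaussian hT]
    simp
  · have h1 : ∀ y : EuclideanSpace ℝ (Fin d), ∫ s, quantizedProduct Δ j k (y, s)
        ∂(Measure.pi fun _ => triangularDither Δ) = y j * y k := by
      intro y
      -- With the sample `y` fixed, only the dithers are random; those of distinct coordinates are
      -- independent, so the means multiply.
      have hind : IndepFun (fun s : Fin d → ℝ => quantize Δ (y j + s j))
          (fun s : Fin d → ℝ => quantize Δ (y k + s k))
          (Measure.pi fun _ => triangularDither Δ) :=
        (iIndepFun_pi (μ := fun _ : Fin d => triangularDither Δ)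
          (X := fun i u => quantize Δ (y i + u)) fun i => by fun_prop).indepFun hjk
      have := hind.integral_fun_mul_eq_mul_integral
        (Measurable.aestronglyMeasurable (by fun_prop))
        (Measurable.aestronglyMeasurable (by fun_prop))
      rw [hcomp j (fun u => quantize Δ (y j + u)) (by fun_prop),
        hcomp k (fun u => quantize Δ (y k + u)) (by fun_prop),
        integral_quantize_triangularDither hΔ, integral_quantize_triangularDither hΔ] at this
      exact this
    simp_rw [h1]
    rw [integral_mul_multivariateGaussian hT, if_neg hjk, add_zero]

end Moments

/-! ### Entrywise accuracy of the estimator and the union bound. -/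

lemma dist_eq_zero_iff {d : ℕ} {j k : Fin d} : dist j k = 0 ↔ j = k := by
  unfold dist
  omega

lemma opNorm_nonneg {d : ℕ} (A : Matrix (Fin d) (Fin d) ℝ) : 0 ≤ opNorm A := norm_nonneg _

lemma scaleK_pos {d : ℕ} (T : Matrix (Fin d) (Fin d) ℝ) {Δ : ℝ} (hΔ : 0 < Δ) :
    0 < scaleK T Δ := by
  have := opNorm_nonneg T
  unfold scaleK
  positivity

lemma pairs_nonempty {d : ℕ} {R : Finset (Fin d)} (hR : IsRuler R) (s : Fin d) :
    (pairs R s).Nonempty := by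
  obtain ⟨j, hj, k, hk, hjk⟩ := hR s
  exact ⟨(j, k), Finset.mem_filter.2 ⟨Finset.mk_mem_product hj hk, hjk⟩⟩

/-- If all averaged products of the data are close to their means, then so are the entries of the
estimator. -/
lemma abs_estimator_sub_lt {d n : ℕ} {a : Fin d → ℝ} {R : Finset (Fin d)} (hR : IsRuler R)
    (hn : 0 < n) (Δ : ℝ) {η : ℝ} (y : Fin n → Fin d → ℝ)
    (hy : ∀ j k, |∑ l, (y l j * y l k - (toep a j k + if j = k then Δ ^ 2 / 4 else 0))| < n * η)
    (j k : Fin d) : |estimator Δ R y j k - toep a j k| < η := by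
  set s : Fin d := ⟨dist j k, dist_lt j k⟩ with hs
  set μ : ℝ := toep a j k + if j = k then Δ ^ 2 / 4 else 0 with hμ
  have hN : (0 : ℝ) < (pairs R s).card := by
    exact_mod_cast Finset.card_pos.2 (pairs_nonempty hR s)
  have hn' : (0 : ℝ) < n := by exact_mod_cast hn
  -- Both the Toeplitz entry and the diagonal correction depend only on the distance, so all pairs
  -- in `R_s` share the mean `μ`.
  have hq : ∀ q ∈ pairs R s, |∑ l, (y l q.1 * y l q.2 - μ)| < n * η := by
    intro q hq
    have hd : dist q.1 q.2 = dist j k := (Finset.mem_filter.1 hq).2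
    have h1 : toep a q.1 q.2 = toep a j k := by simp only [toep, Matrix.of_apply, hd]
    have h2 : q.1 = q.2 ↔ j = k := by rw [← dist_eq_zero_iff, hd, dist_eq_zero_iff]
    have h3 := hy q.1 q.2
    simpa only [h1, h2, ← hμ] using h3
  have h1 : estimator Δ R y j k - toep a j k = aDot R y s - μ := by
    simp only [estimator, toep, Matrix.sub_apply, Matrix.of_apply, Matrix.smul_apply,
      Matrix.one_apply, smul_eq_mul, hμ, hs]
    split_ifs <;> ring
  have h2 : aDot R y s - μ =
      (1 / (n * (pairs R s).card : ℝ)) * ∑ q ∈ pairs R s, ∑ l, (y l q.1 * y l q.2 - μ) := by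
    simp only [Finset.sum_sub_distrib, Finset.sum_const, Finset.card_univ, Fintype.card_fin,
      nsmul_eq_mul, aDot]
    rw [Finset.sum_comm]
    field_simp
  rw [h1, h2, abs_mul, abs_of_pos (by positivity), one_div, inv_mul_lt_iff₀ (by positivity)]
  calc |∑ q ∈ pairs R s, ∑ l, (y l q.1 * y l q.2 - μ)|
      ≤ ∑ q ∈ pairs R s, |∑ l, (y l q.1 * y l q.2 - μ)| := Finset.abs_sum_le_sum_abs _ _
    _ < ∑ q ∈ pairs R s, n * η := Finset.sum_lt_sum_of_nonempty (pairs_nonempty hR s) hq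
    _ = n * (pairs R s).card * η := by rw [Finset.sum_const, nsmul_eq_mul]; ring

/-- Concentration of a single averaged product of quantized data. -/
lemma IsDitheredGaussianSample.measureReal_abs_sum_ge_le {d n : ℕ} {Ω : Type*}
    [MeasurableSpace Ω] {P : Measure Ω} [IsProbabilityMeasure P]
    {T : Matrix (Fin d) (Fin d) ℝ} {Δ : ℝ} {x : Fin n → Ω → EuclideanSpace ℝ (Fin d)}
    {τ : Fin n → Fin d → Ω → ℝ} (h : IsDitheredGaussianSample P T Δ x τ) (hT : T.PosSemidef)
    (hΔ : 0 < Δ) {t : ℝ} (ht0 : 0 ≤ t) (ht : t ≤ 1 / 2) (ε : ℝ) (j k : Fin d) :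
    P.real {ω | 8 * scaleK T Δ * ε ≤ |∑ l, (quantizedData Δ x τ ω l j * quantizedData Δ x τ ω l k -
        (T j k + if j = k then Δ ^ 2 / 4 else 0))|} ≤
      2 * Real.exp (-t * ε + n * (96 * t ^ 2)) := by
  -- This is `16 ‖T‖ + 32 Δ²`, ample for both scale conditions of the exponential moment bound.
  set B := 8 * scaleK T Δ with hBdef
  have hB : 0 < B := by have := scaleK_pos T hΔ; positivity
  have hTB : ∀ i, 8 * T i i ≤ B := fun i => by
    have h1 := apply_self_le_opNorm T i
    have h2 := opNorm_nonneg T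
    rw [hBdef, scaleK]
    nlinarith [sq_nonneg Δ]
  have hΔB : 9 / 2 * Δ ^ 2 ≤ B := by
    have h2 := opNorm_nonneg T
    rw [hBdef, scaleK]
    nlinarith [sq_nonneg Δ]
  obtain ⟨hint, hle⟩ := integrable_exp_abs_quantizedProduct hT hΔ hTB hΔB j k
  have hlaw := h.hasLaw_pair
  have hmean : ∀ l, ∫ ω, quantizedProduct Δ j k (x l ω, fun j => τ l j ω) / B ∂P =
      (T j k + if j = k then Δ ^ 2 / 4 else 0) / B := by
    intro l
    rw [integral_div, ← integral_quantizedProduct hT hΔ j k]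
    congr 1
    exact (hlaw l).integral_comp (f := quantizedProduct Δ j k)
      (measurable_quantizedProduct Δ j k).aestronglyMeasurable
  have hexp : Measurable fun z : EuclideanSpace ℝ (Fin d) × (Fin d → ℝ) =>
      Real.exp |quantizedProduct Δ j k z / B| := by fun_prop
  have key := measureReal_abs_sum_sub_integral_ge_le (P := P) (n := n)
    (W := fun l ω => quantizedProduct Δ j k (x l ω, fun j => τ l j ω) / B) (M := 6)
    (fun l => ((measurable_quantizedProduct Δ j k).comp_aemeasurable
      (hlaw l).aemeasurable).div_const B)
    (h.iIndepFun_pair.comp (fun _ z => quantizedProduct Δ j k z / B) fun _ => by fun_prop)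
    (fun l => by
      have h1 := hint
      rw [← (hlaw l).map_eq] at h1
      exact h1.comp_aemeasurable (hlaw l).aemeasurable)
    (fun l => le_of_eq_of_le ((hlaw l).integral_comp hexp.aestronglyMeasurable) hle) ht0 ht ε
  refine le_trans (le_of_eq ?_) (key.trans (le_of_eq ?_))
  · congr 1
    ext ω
    simp only [hmean, Set.mem_ofPred_eq]
    rw [Finset.sum_congr rfl fun l _ => (sub_div (quantizedProduct Δ j k
      (x l ω, fun j => τ l j ω)) (T j k + if j = k then Δ ^ 2 / 4 else 0) B).symm,
      ← Finset.sum_div, abs_div, abs_of_pos hB, le_div_iff₀ hB, mul_comm]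
    rfl
  · norm_num

lemma logTerm_ge {d : ℕ} (R : Finset (Fin d)) (p : ℝ) : 4 * p * Real.log d ≤ logTerm R p := by
  have : 0 ≤ Real.log (R.card : ℝ) := Real.log_natCast_nonneg _
  unfold logTerm
  linarith

lemma log_two_le_log_natCast {d : ℕ} (hd : 2 ≤ d) : 1 / 2 ≤ Real.log d := by
  have h1 : Real.log 2 ≤ Real.log d := Real.log_le_log (by norm_num) (by exact_mod_cast hd)
  linarith [Real.log_two_gt_d9]

lemma logTerm_pos {d : ℕ} (hd : 2 ≤ d) (R : Finset (Fin d)) {p : ℝ} (hp : 1 < p) :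
    0 < logTerm R p := by
  have h1 := logTerm_ge R p
  have h2 := log_two_le_log_natCast hd
  have h3 : 0 < 4 * p * Real.log d := by positivity
  linarith

/-- The union bound over all pairs of indices. -/
lemma sq_mul_two_mul_exp_le {d : ℕ} (hd : 2 ≤ d) (R : Finset (Fin d)) {p : ℝ} (hp : 1 < p) :
    (d : ℝ) ^ 2 * (2 * Real.exp (-(2 * logTerm R p))) ≤ Real.exp (-p) := by
  have h1 := logTerm_ge R p
  have h2 := log_two_le_log_natCast hd
  have hd0 : (0 : ℝ) < d := by positivity
  have hd2 : (2 : ℝ) ≤ d := by exact_mod_cast hd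
  have hd3 : (d : ℝ) = Real.exp (Real.log d) := (Real.exp_log hd0).symm
  calc (d : ℝ) ^ 2 * (2 * Real.exp (-(2 * logTerm R p)))
      -- The factor 2 is absorbed into a third power of `d`, using `2 ≤ d`.
      ≤ (d : ℝ) ^ 2 * (d * Real.exp (-(2 * logTerm R p))) := by gcongr
    _ = Real.exp (3 * Real.log d - 2 * logTerm R p) := by
        rw [← mul_assoc, ← pow_succ, hd3, ← Real.exp_nat_mul, ← Real.exp_add, ← hd3]
        congr 1
    -- The exponent is at most `(3 - 8p) log d ≤ -5p log d ≤ -5p/2`, by `p > 1` and `log d ≥ 1/2`.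
    _ ≤ Real.exp (-p) := by
        rw [Real.exp_le_exp]
        nlinarith

end QToep

end

/-! ### Choice of constants and conclusion. -/

theorem mainTheorem6 :
    ∀ c : ℝ, 0 < c → ∃ C₀ : ℝ, 0 < C₀ ∧ ∀ C : ℝ, C₀ ≤ C → ∃ C' : ℝ, 0 < C' ∧
      ∀ (d m n : ℕ) (a : Fin d → ℝ) (R : Finset (Fin d)) (Δ p : ℝ)
        (Ω : Type*) [MeasurableSpace Ω] (P : Measure Ω) [IsProbabilityMeasure P]
        (x : Fin n → Ω → EuclideanSpace ℝ (Fin d)) (τ : Fin n → Fin d → Ω → ℝ),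
        0 < m → m < d →
        (QToep.toep a).PosSemidef →
        (∀ s : Fin d, m ≤ (s : ℕ) → a s = 0) →
        QToep.IsRuler R →
        0 < Δ →
        1 < p →
        c * QToep.logTerm R p ≤ (n : ℝ) →
        QToep.IsDitheredGaussianSample P (QToep.toep a) Δ x τ →
        1 - Real.exp (-p) ≤
          P.real {ω |
            QToep.opNorm (QToep.toep a -
                QToep.threshold
                  (C * QToep.scaleK (QToep.toep a) Δ * √(QToep.logTerm R p / (n : ℝ)))
                  (QToep.estimator Δ R (QToep.quantizedData Δ x τ ω))) ≤
              C' * QToep.scaleK (QToep.toep a) Δ * (m : ℝ) *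
                √(QToep.logTerm R p / (n : ℝ))} := by
  intro c hc
  -- The Bernstein parameter will be `t = κ r` with `r = √(L / n)`; since `c L ≤ n` gives `√c r ≤
  -- 1`, this is at most 1/2.
  set κ : ℝ := √c / 2 with hκ
  have hκ0 : 0 < κ := by positivity
  -- Chosen so that `κ A - 96 κ² = 2`, which makes the Bernstein exponent exactly `-2L`; here `96 =
  -- 16 * 6`.
  set A : ℝ := (2 + 96 * κ ^ 2) / κ with hA
  have hA0 : 0 < A := by positivity
  -- The entrywise accuracy is `η = 8 A K r`, so `C ≥ 8 A` means `η ≤ ζ`, and `2m(η + ζ)` gives the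
  -- final constant.
  refine ⟨8 * A, by positivity, fun C hC => ⟨2 * (8 * A + C), by linarith, ?_⟩⟩
  intro d m n a R Δ p Ω _ P _ x τ hm hmd hT ha hR hΔ hp hn h
  have hd : 2 ≤ d := by omega
  set T := QToep.toep a with hTdef
  set L := QToep.logTerm R p with hL
  have hL0 : 0 < L := QToep.logTerm_pos hd R hp
  set K := QToep.scaleK T Δ with hK
  have hK0 : 0 < K := QToep.scaleK_pos T hΔ
  have hn0 : (0 : ℝ) < n := lt_of_lt_of_le (by positivity) hn
  set r : ℝ := √(L / n) with hr
  have hr0 : 0 < r := by positivity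
  have hr2 : n * r ^ 2 = L := by
    rw [hr, Real.sq_sqrt (by positivity)]; field_simp
  have hκr : κ * r ≤ 1 / 2 := by
    have h1 : √c * r ≤ 1 := by
      rw [hr, ← Real.sqrt_mul hc.le, Real.sqrt_le_left zero_le_one, ← mul_div_assoc,
        div_le_iff₀ hn0]
      linarith
    rw [hκ]; linarith
  have hexp : -(κ * r) * (n * (A * r)) + n * (96 * (κ * r) ^ 2) = -(2 * L) := by
    have h1 : κ * A = 2 + 96 * κ ^ 2 := by rw [hA]; field_simp
    calc _ = -(n * r ^ 2) * (κ * A - 96 * κ ^ 2) := by ring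
      _ = _ := by rw [h1, hr2]; ring
  let bad : Fin d × Fin d → Set Ω := fun q =>
    {ω | 8 * K * (n * (A * r)) ≤ |∑ l, (QToep.quantizedData Δ x τ ω l q.1 *
      QToep.quantizedData Δ x τ ω l q.2 -
        (T q.1 q.2 + if q.1 = q.2 then Δ ^ 2 / 4 else 0))|}
  have hbad : ∀ q, P.real (bad q) ≤ 2 * Real.exp (-(2 * L)) := by
    intro q
    have h1 := h.measureReal_abs_sum_ge_le hT hΔ (by positivity) hκr (n * (A * r)) q.1 q.2
    rwa [hexp] at h1
  have hunion : P.real (⋃ q, bad q) ≤ Real.exp (-p) := by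
    calc P.real (⋃ q, bad q) ≤ ∑ q, P.real (bad q) := measureReal_iUnion_fintype_le _
      _ ≤ ∑ _q : Fin d × Fin d, 2 * Real.exp (-(2 * L)) := Finset.sum_le_sum fun q _ => hbad q
      _ = (d : ℝ) ^ 2 * (2 * Real.exp (-(2 * L))) := by
          rw [Finset.sum_const, Finset.card_univ, Fintype.card_prod, Fintype.card_fin, nsmul_eq_mul]
          push_cast
          ring
      _ ≤ _ := QToep.sq_mul_two_mul_exp_le hd R hp
  set good := {ω | QToep.opNorm (T - QToep.threshold (C * K * r)
    (QToep.estimator Δ R (QToep.quantizedData Δ x τ ω))) ≤ 2 * (8 * A + C) * K * m * r} with hgood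
  -- Covering the space and using subadditivity avoids any measurability question about `good`.
  have hcover : Set.univ ⊆ (⋃ q, bad q) ∪ good := by
    intro ω _
    by_cases hω : ω ∈ ⋃ q, bad q
    · exact Or.inl hω
    · refine Or.inr ?_
      have hω' : ∀ j k, |∑ l, (QToep.quantizedData Δ x τ ω l j *
          QToep.quantizedData Δ x τ ω l k - (T j k + if j = k then Δ ^ 2 / 4 else 0))| <
          n * (8 * A * K * r) := by
        intro j k
        by_contra hge
        refine hω (Set.mem_iUnion.2 ⟨(j, k), ?_⟩)
        change 8 * K * (n * (A * r)) ≤ _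
        linarith
      have hE := QToep.abs_estimator_sub_lt hR (by exact_mod_cast hn0) Δ _ hω'
      have hb := QToep.opNorm_sub_threshold_le m (η := 8 * A * K * r) (ζ := C * K * r)
        (by positivity) (by gcongr) (fun j k hjk => ha ⟨_, QToep.dist_lt j k⟩ hjk) hE
      refine hb.trans (le_of_eq ?_)
      ring
  have h1 : (1 : ℝ) ≤ P.real ((⋃ q, bad q) ∪ good) := by
    rw [← probReal_univ (μ := P)]
    exact measureReal_mono hcover
  have h2 := measureReal_union_le (μ := P) (⋃ q, bad q) good
  linarith
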